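/- All graphs are finite, simple and connected. A signed graph $G_\sigma$ is a graph $G$ together with a map $\sigma : E(G) \to \{+1,-1\}$. Its Laplacian is $L(G_\sigma) = D - A_\sigma$, where $D$ is the diagonal matrix of vertex degrees and $A_\sigma$ is the signed adjacency matrix, with entry $\sigma(xy)$ at $(x,y)$ if $xy$ is an edge and $0$ otherwise; the Laplacian $L(G)$ of an ordinary graph is the case $\sigma \equiv +1$. The critical group $\mathcal{K}(G_\sigma)$ is the torsion subgroup of the cokernel of $L(G_\sigma)$ over $\mathbb{Z}$. For an integer $N \ge 2$, an $N$-colored Adinkra is a signed graph $\mathcal{A} = G_\sigma$ with each edge colored by one of $N$ colors such that: (1) $G$ is bipartite; (2) every vertex is incident to exactly one edge of each color; (3) for every pair of distinct colors, the graph restricted to the edges of these two colors is a disjoint union of $4$-cycles; (4) each such bi-colored $4$-cycle contains an odd number of negative edges. **Theorem.** Let $\mathcal{A}$ be an $N$-colored Adinkra on $v$ vertices, $N \ge 2$, with underlying graph $G$. Then $v$ is even, and if the rank over $\mathbb{F}_2$ of the Laplacian $L(G)$ is written as $v/2 - m$, then $m \ge 0$ and $$\mathcal{K}(\mathcal{A})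 \cong (\mathbb{Z}/2\mathbb{Z})^m \oplus \left(\mathbb{Z}/\tfrac{N^2-N}{2}\mathbb{Z}\right)^m \oplus \left(\mathbb{Z}/(N^2-N)\mathbb{Z}\right)^{v/2-m}.$$ -/

import Mathlib

/-- A signed graph: a simple graph with a sign `1` or `-1` on every edge. -/
structure SignedGraph (V : Type*) where
  /-- the underlying graph -/
  graph : SimpleGraph V
  /-- the signature -/
  sign : graph.EdgeLabeling ℤˣ

namespace SignedGraph

variable {V : Type*} (S : SignedGraph V)

/-- The graph formed by the negative edges. -/
def negGraph : SimpleGraph V := S.sign.labelGraph (-1)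

/-- The signed adjacency matrix: `1` at a positive edge, `-1` at a negative edge, `0` elsewhere. -/
def signedAdjMatrix [DecidableRel S.graph.Adj] : Matrix V V ℤ :=
  Matrix.of fun x y => if h : S.graph.Adj x y then ((S.sign.get x y h : ℤˣ) : ℤ) else 0

/-- The Laplacian of a signed graph: degree matrix minus signed adjacency matrix. -/
def laplacian [Fintype V] [DecidableEq V] [DecidableRel S.graph.Adj] : Matrix V V ℤ :=
  S.graph.degMatrix ℤ - S.signedAdjMatrix

/-- The critical group: the torsion part of the cokernel of the Laplacian over `ℤ`. -/
abbrev CriticalGroup [Fintype V] [DecidableEq V] [DecidableRel S.graph.Adj] :=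
  Submodule.torsion ℤ ((V → ℤ) ⧸ LinearMap.range S.laplacian.mulVecLin)

end SignedGraph

/-- The graph formed by the edges having color `i` or color `j`. -/
def SimpleGraph.EdgeLabeling.bicolorGraph {V K : Type*} {G : SimpleGraph V}
    (c : G.EdgeLabeling K) (i j : K) : SimpleGraph V :=
  c.labelGraph i ⊔ c.labelGraph j

/-- An `N`-colored Adinkra with vertex set `V`. -/
structure Adinkra (V : Type*) (N : ℕ) extends SignedGraph V where
  /-- the color of each edge -/
  color : graph.EdgeLabeling (Fin N)
  connected : graph.Connected
  bipartite : graph.IsBipartite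
  /-- every vertex is incident to exactly one edge of each color -/
  existsUnique_edge : ∀ (v : V) (i : Fin N),
    ∃! e : graph.edgeSet, v ∈ (e : Sym2 V) ∧ color e = i
  /-- the edges of two distinct colors form a disjoint union of 4-cycles -/
  bicolor_component : ∀ i j : Fin N, i ≠ j →
    ∀ C : (color.bicolorGraph i j).ConnectedComponent,
      Nonempty (C.toSimpleGraph ≃g SimpleGraph.cycleGraph 4)
  /-- each bi-colored 4-cycle contains an odd number of negative edges -/
  odd_negative : ∀ i j : Fin N, i ≠ j →
    ∀ (v : V) (p : (color.bicolorGraph i j).Walk v v), p.IsCycle → p.length = 4 →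
      Odd (p.edgeSet ∩ toSignedGraph.negGraph.edgeSet).ncard

/-- The 2-rank of the Laplacian of a graph: its rank over the field with two elements. -/
noncomputable def SimpleGraph.laplacianTwoRank {V : Type*} (G : SimpleGraph V)
    [Fintype V] [DecidableEq V] [DecidableRel G.Adj] : ℕ :=
  ((G.lapMatrix ℤ).map (Int.castRingHom (ZMod 2))).rank

/-! The signed adjacency matrix `S` is a sum of color matrices `C i`, each a signed permutation
matrix of a perfect matching. Matchings are involutions and every bicolored square carries an odd
number of minus signs, so the `C i` satisfy the Clifford relations: they square to `1` and
anticommute. Hence `S² = N`, and `L = N - S`, `L' = N + S` satisfy `L L' = M` with `M = N² - N`. Two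
further relations do the rest: the sign `J` of the bipartition gives `J L J = L'`, and any color
matrix `T` gives `T L - L' T = -2`.

Put `L` in Smith form with entries `d i`; the same base changes make `L'` diagonal with entries `e
i`, where `d i * e i = M`. The relation with `T` forces `gcd (d i) (e i) ∣ 2`, and `J` makes the
ranks of `L` and `L'` modulo each prime equal. With `μ` the `p`-adic valuation of `M`, for odd `p`
half of the `d i` have valuation `0` and half `μ`. For `p = 2` the valuations lie in `{0, 1, μ - 1,
μ}`; the 2-rank counts the extreme ones, and `det L ^ 2 = M ^ v` balances the other two. These
multiplicities determine the cokernel (`Matrix.nonempty_quotient_range_addEquiv`), which is finite,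
hence all torsion. Signs vanish modulo `2`, so the 2-rank is that of the unsigned graph. -/

/-! ### Finite products of cyclic groups and their elementary divisors -/

/-- Two families of the same size whose values have the same multiplicities differ by a
bijection of the index types. -/
theorem exists_equiv_comp_eq {α β : Type*} [Fintype α] [Fintype β] (f : α → ℕ) (g : β → ℕ)
    (h : ∀ k, (∑ i, if f i = k then 1 else 0) = ∑ j, if g j = k then 1 else 0) :
    ∃ e : α ≃ β, ∀ i, g (e i) = f i := by
  have hk : ∀ k, Nonempty ({i // f i = k} ≃ {j // g j = k}) := fun k => by
    refine ⟨Fintype.equivOfCardEq ?_⟩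
    simpa [Fintype.card_subtype, Finset.sum_boole] using h k
  let e k := (hk k).some
  refine ⟨(Equiv.sigmaFiberEquiv f).symm.trans
    ((Equiv.sigmaCongrRight e).trans (Equiv.sigmaFiberEquiv g)), fun i => ?_⟩
  exact (e (f i) ⟨i, rfl⟩).2

/-- Chinese remainder decomposition over any finite set of primes supporting `n`. -/
theorem nonempty_zmod_addEquiv_pi {s : Finset ℕ} (hs : ∀ p ∈ s, p.Prime) {n : ℕ} (hn : n ≠ 0)
    (hns : n.primeFactors ⊆ s) :
    Nonempty (ZMod n ≃+ ((p : s) → ZMod ((p : ℕ) ^ n.factorization p))) := by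
  have hprod : ∏ p : s, (p : ℕ) ^ n.factorization p = n := by
    rw [Finset.prod_coe_sort s (fun p => p ^ n.factorization p)]
    conv_rhs => rw [← Nat.prod_factorization_pow_eq_self hn]
    exact (Finsupp.prod_of_support_subset _ (by simpa using hns) _ (by simp)).symm
  have hco : Pairwise (Function.onFun Nat.Coprime
      fun p : s => (p : ℕ) ^ n.factorization p) := fun p q hpq =>
    Nat.coprime_pow_primes _ _ (hs p p.2) (hs q q.2) (fun h => hpq (Subtype.ext h))
  exact ⟨((ZMod.ringEquivCongr hprod.symm).trans (ZMod.prodEquivPi _ hco)).toAddEquiv⟩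

/-- Products of finite cyclic groups whose orders have the same elementary divisors are
isomorphic. -/
theorem nonempty_pi_zmod_addEquiv {α β : Type*} [Fintype α] [Fintype β] {d : α → ℕ} {e : β → ℕ}
    (hd : ∀ i, d i ≠ 0) (he : ∀ j, e j ≠ 0)
    (h : ∀ p, p.Prime → ∀ k, (∑ i, if (d i).factorization p = k then 1 else 0) =
      ∑ j, if (e j).factorization p = k then 1 else 0) :
    Nonempty (((i : α) → ZMod (d i)) ≃+ ((j : β) → ZMod (e j))) := by
  classical
  -- One set of primes serves both families; exponent `0` contributes the trivial group `ZMod 1`.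
  let s : Finset ℕ := (Finset.univ.biUnion fun i => (d i).primeFactors) ∪
    Finset.univ.biUnion fun j => (e j).primeFactors
  have hs : ∀ p ∈ s, p.Prime := fun p hp => by
    simp only [s, Finset.mem_union, Finset.mem_biUnion] at hp
    rcases hp with ⟨_, _, hp⟩ | ⟨_, _, hp⟩ <;> exact Nat.prime_of_mem_primeFactors hp
  have ed := fun i => Classical.choice <| nonempty_zmod_addEquiv_pi hs (hd i)
    ((Finset.subset_biUnion_of_mem (fun i => (d i).primeFactors) (Finset.mem_univ i)).trans
      Finset.subset_union_left)
  have ee := fun j => Classical.choice <| nonempty_zmod_addEquiv_pi hs (he j)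
    ((Finset.subset_biUnion_of_mem (fun j => (e j).primeFactors) (Finset.mem_univ j)).trans
      Finset.subset_union_right)
  -- The matching of indices depends on the prime, so the product over primes has to be moved
  -- outside.
  choose σ hσ using fun p : s => exists_equiv_comp_eq _ _ (h p (hs p p.2))
  let swapd : ((i : α) → (p : s) → ZMod ((p : ℕ) ^ (d i).factorization p)) ≃+
      ((p : s) → (i : α) → ZMod ((p : ℕ) ^ (d i).factorization p)) :=
    { Equiv.piComm _ with map_add' := fun _ _ => rfl }
  let swape : ((j : β) → (p : s) → ZMod ((p : ℕ) ^ (e j).factorization p)) ≃+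
      ((p : s) → (j : β) → ZMod ((p : ℕ) ^ (e j).factorization p)) :=
    { Equiv.piComm _ with map_add' := fun _ _ => rfl }
  let mid (p : s) : ((i : α) → ZMod ((p : ℕ) ^ (d i).factorization p)) ≃+
      ((j : β) → ZMod ((p : ℕ) ^ (e j).factorization p)) :=
    (AddEquiv.piCongrRight fun i =>
      (ZMod.ringEquivCongr (by rw [hσ p i])).toAddEquiv).trans
      { Equiv.piCongrLeft (fun j => ZMod ((p : ℕ) ^ (e j).factorization p)) (σ p) with
        map_add' := fun x y => by
          ext j
          obtain ⟨i, rfl⟩ := (σ p).surjective j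
          simp [Equiv.piCongrLeft_apply_apply] }
  exact ⟨(AddEquiv.piCongrRight ed).trans (swapd.trans ((AddEquiv.piCongrRight mid).trans
    (swape.symm.trans (AddEquiv.piCongrRight ee).symm)))⟩

/-! ### Smith form over `ℤ` and rank modulo a prime -/

/-- Diagonalization of a nonsingular integer matrix, together with the resulting description of
its cokernel. -/
theorem Matrix.exists_mul_eq_mul_diagonal {ι : Type*} [Fintype ι] [DecidableEq ι]
    (L : Matrix ι ι ℤ) (hL : L.det ≠ 0) :
    ∃ (P Q : Matrix ι ι ℤ) (d : ι → ℤ), IsUnit P.det ∧ IsUnit Q.det ∧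
      L * Q = P * Matrix.diagonal d ∧
      Nonempty (((ι → ℤ) ⧸ LinearMap.range L.mulVecLin) ≃+ ((i : ι) → ZMod (d i).natAbs)) := by
  have hinj : Function.Injective L.mulVecLin := Matrix.mulVec_injective_of_det_ne_zero hL
  let eL : (ι → ℤ) ≃ₗ[ℤ] LinearMap.range L.mulVecLin := LinearEquiv.ofInjective _ hinj
  have hrank : Module.finrank ℤ (LinearMap.range L.mulVecLin) = Module.finrank ℤ (ι → ℤ) :=
    eL.finrank_eq.symm
  let b := Pi.basisFun ℤ ι
  let bT := Submodule.smithNormalFormTopBasis b hrank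
  -- Pulling the adapted basis of the image back along `L` gives the columns of `Q`: `L` sends `bB
  -- j` to `d j • bT j`.
  let bB := (Submodule.smithNormalFormBotBasis b hrank).map eL.symm
  have hunit : ∀ c : Module.Basis ι ℤ (ι → ℤ), IsUnit (b.toMatrix c).det := fun c =>
    Matrix.isUnit_det_of_right_inverse (b.toMatrix_mul_toMatrix_flip c)
  refine ⟨b.toMatrix bT, b.toMatrix bB, Submodule.smithNormalFormCoeffs b hrank, hunit _, hunit _,
    ?_, ⟨Submodule.quotientEquivPiZMod _ b hrank⟩⟩
  ext i j
  have h1 : L.mulVec (bB j) = Submodule.smithNormalFormCoeffs b hrank j • bT j := by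
    have := Submodule.smithNormalFormBotBasis_def b hrank j
    rw [← this]
    have h2 : eL (bB j) = Submodule.smithNormalFormBotBasis b hrank j := by simp [bB]
    rw [← h2]
    rfl
  have h3 := congrFun h1 i
  simp only [Matrix.mulVec, dotProduct, Pi.smul_apply, smul_eq_mul] at h3
  rw [Matrix.mul_diagonal, Matrix.mul_apply]
  simpa [Module.Basis.toMatrix_apply, b, mul_comm] using h3

/-- The rank modulo a prime of a matrix equivalent to a diagonal one. -/
theorem Matrix.rank_map_zmod_of_mul_eq_mul_diagonal {ι : Type*} [Fintype ι] [DecidableEq ι]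
    {L P Q : Matrix ι ι ℤ} {d : ι → ℤ} (hP : IsUnit P.det) (hQ : IsUnit Q.det)
    (h : L * Q = P * Matrix.diagonal d) (p : ℕ) [Fact p.Prime] :
    (L.map (Int.castRingHom (ZMod p))).rank = ∑ i, if (p : ℤ) ∣ d i then 0 else 1 := by
  have hu : ∀ X : Matrix ι ι ℤ, IsUnit X.det → IsUnit (X.map (Int.castRingHom (ZMod p))).det :=
    fun X hX => by
      have := hX.map (Int.castRingHom (ZMod p))
      rwa [RingHom.map_det] at this
  have h' := congrArg (fun X : Matrix ι ι ℤ => X.map (Int.castRingHom (ZMod p))) h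
  simp only [Matrix.map_mul] at h'
  rw [← Matrix.rank_mul_eq_left_of_isUnit_det _ _ (hu Q hQ), h',
    Matrix.rank_mul_eq_right_of_isUnit_det _ _ (hu P hP),
    Matrix.diagonal_map (map_zero _), Matrix.rank_diagonal, Fintype.card_subtype,
    Finset.card_filter]
  refine Finset.sum_congr rfl fun i _ => ?_
  have : ((Int.castRingHom (ZMod p)) (d i) ≠ 0) ↔ ¬ (p : ℤ) ∣ d i := by
    simp [ZMod.intCast_zmod_eq_zero_iff_dvd]
  by_cases hd : (p : ℤ) ∣ d i <;> simp_all

/-! ### Counting valuations -/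

/-- Value multiplicities of a function with values `0` and `μ` only, both equally frequent. -/
theorem sum_ite_eq_of_eq_zero_or_eq {ι : Type*} [Fintype ι] {f : ι → ℕ} {n μ : ℕ}
    (hcard : Fintype.card ι = 2 * n) (hf : ∀ i, f i = 0 ∨ f i = μ)
    (h0 : (∑ i, if f i = 0 then 1 else 0) = ∑ i, if f i = μ then 1 else 0) (k : ℕ) :
    (∑ i, if f i = k then 1 else 0) = n * (if 0 = k then 1 else 0) + n * if μ = k then 1 else 0 := by
  have hone : (∑ _i : ι, 1) = 2 * n := by simp [hcard]
  by_cases hμ : μ = 0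
  · subst hμ
    have : ∀ i, f i = 0 := fun i => by simpa using hf i
    simp only [this, Finset.sum_const, Finset.card_univ, hcard, smul_eq_mul]
    ring
  have hsum : (∑ i, if f i = 0 then 1 else 0) + (∑ i, if f i = μ then 1 else 0) = 2 * n := by
    rw [← hone, ← Finset.sum_add_distrib]
    refine Finset.sum_congr rfl fun i _ => ?_
    rcases hf i with h | h <;> simp [h, hμ, Ne.symm hμ]
  by_cases hk0 : 0 = k
  · subst hk0
    simp only [hμ, if_true, if_false]; omega
  by_cases hkμ : μ = k
  · subst hkμ
    simp only [hk0, if_true, if_false]; omega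
  have : ∀ i, f i ≠ k := fun i => by rcases hf i with h | h <;> omega
  simp [this, hk0, hkμ]

/-- Value multiplicities of a function with values `0`, `1`, `μ - 1` and `μ` only, determined by
the multiplicities of `0` and `μ` and by the sum of the values. -/
theorem sum_ite_eq_of_eq_zero_or_one_or {ι : Type*} [Fintype ι] {f : ι → ℕ} {n m μ : ℕ}
    (hcard : Fintype.card ι = 2 * n) (hμ : 1 ≤ μ)
    (hf : ∀ i, f i = 0 ∨ f i = 1 ∨ f i + 1 = μ ∨ f i = μ)
    (h0 : (∑ i, if f i = 0 then 1 else 0) + m = n)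
    (hlast : (∑ i, if f i = μ then 1 else 0) + m = n)
    (hsum : ∑ i, f i = n * μ) (k : ℕ) :
    (∑ i, if f i = k then 1 else 0) = m * (if 1 = k then 1 else 0) +
      (m * (if μ - 1 = k then 1 else 0) + ((n - m) * (if μ = k then 1 else 0) +
        (n - m) * if 0 = k then 1 else 0)) := by
  have hone : (∑ _i : ι, 1) = 2 * n := by simp [hcard]
  have hzero : ∀ k, k ≠ 0 → k ≠ 1 → k + 1 ≠ μ → k ≠ μ → (∑ i, if f i = k then 1 else 0) = 0 := by
    intro k h1 h2 h3 h4
    refine Finset.sum_eq_zero fun i _ => if_neg ?_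
    rcases hf i with h | h | h | h <;> omega
  -- For `μ = 1` or `μ = 2` the values `0, 1, μ - 1, μ` collide; the total count then suffices.
  obtain rfl | rfl | hμ3 : μ = 1 ∨ μ = 2 ∨ 3 ≤ μ := by omega
  · have : (∑ i, if f i = 0 then 1 else 0) + (∑ i, if f i = 1 then 1 else 0) = 2 * n := by
      rw [← hone, ← Finset.sum_add_distrib]
      refine Finset.sum_congr rfl fun i _ => ?_
      rcases hf i with h | h | h | h <;> simp_all
    have hm : m = 0 := by omega
    subst hm
    rcases Nat.lt_or_ge 1 k with hk | hk
    · rw [hzero k (by omega) (by omega) (by omega) (by omega)]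
      simp [show 1 ≠ k by omega, show 0 ≠ k by omega]
    · interval_cases k <;> simp [-Finset.sum_boole] <;> omega
  · have : (∑ i, if f i = 0 then 1 else 0) + (∑ i, if f i = 1 then 1 else 0) +
        (∑ i, if f i = 2 then 1 else 0) = 2 * n := by
      rw [← hone, ← Finset.sum_add_distrib, ← Finset.sum_add_distrib]
      refine Finset.sum_congr rfl fun i _ => ?_
      rcases hf i with h | h | h | h <;> simp_all
    rcases Nat.lt_or_ge 2 k with hk | hk
    · rw [hzero k (by omega) (by omega) (by omega) (by omega)]
      simp [show 1 ≠ k by omega, show 0 ≠ k by omega, show 2 ≠ k by omega]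
    · interval_cases k <;> simp [-Finset.sum_boole] <;> omega
  · obtain ⟨ν, rfl⟩ : ∃ ν, μ = ν + 3 := ⟨μ - 3, by omega⟩
    set c0 := ∑ i, if f i = 0 then 1 else 0 with hc0
    set cl := ∑ i, if f i = ν + 3 then 1 else 0 with hcl
    set c1 := ∑ i, if f i = 1 then 1 else 0 with hc1
    set cp := ∑ i, if f i = ν + 2 then 1 else 0 with hcp
    have hA : c0 + c1 + cp + cl = 2 * n := by
      rw [← hone, hc0, hc1, hcp, hcl, ← Finset.sum_add_distrib, ← Finset.sum_add_distrib,
        ← Finset.sum_add_distrib]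
      refine Finset.sum_congr rfl fun i _ => ?_
      split_ifs <;> first | rfl | (exfalso; rcases hf i with h | h | h | h <;> omega)
    have hB : c1 + (ν + 2) * cp + (ν + 3) * cl = n * (ν + 3) := by
      rw [← hsum, hc1, hcp, hcl, Finset.mul_sum, Finset.mul_sum, ← Finset.sum_add_distrib,
        ← Finset.sum_add_distrib]
      refine Finset.sum_congr rfl fun i _ => ?_
      rcases hf i with h | h | h | h
      · simp [h]
      · simp [h]
      · obtain h : f i = ν + 2 := by omega
        simp [h]
      · simp [h]
    obtain rfl : n = cl + m := hlast.symm
    have hc1m : c1 + cp = 2 * m := by omega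
    -- Substituting `c1 = 2m - cp` and `n = cl + m` in the sum of values leaves `(ν + 1) cp = (ν +
    -- 1) m`.
    have hcpm : cp = m := by
      have : (ν + 1) * cp = (ν + 1) * m := by nlinarith
      exact Nat.eq_of_mul_eq_mul_left (Nat.succ_pos ν) this
    have hc1m' : c1 = m := by omega
    by_cases hk0 : k = 0
    · subst hk0; simp [-Finset.sum_boole]; omega
    by_cases hk1 : k = 1
    · subst hk1; simp [-Finset.sum_boole]; omega
    by_cases hkp : k = ν + 2
    · subst hkp; simp [-Finset.sum_boole]; omega
    by_cases hkl : k = ν + 3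
    · subst hkl; simp [-Finset.sum_boole]; omega
    rw [hzero k hk0 hk1 (by omega) hkl]
    simp [Ne.symm hk0, Ne.symm hk1, Ne.symm hkl, Ne.symm hkp]

/-! ### From complementary orders to the cokernel -/

/-- The cyclic decomposition determined by orders `d i` with complementary orders `e i`. -/
theorem nonempty_pi_zmod_addEquiv_of_mul_eq {ι : Type*} [Fintype ι] {d e : ι → ℕ} {M n m : ℕ}
    (hM : M ≠ 0) (hM2 : 2 ∣ M) (hcard : Fintype.card ι = 2 * n) (hde : ∀ i, d i * e i = M)
    (hgcd : ∀ i, (d i).gcd (e i) ∣ 2)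
    (hcount : ∀ p, p.Prime →
      (∑ i, if p ∣ d i then 0 else 1) = ∑ i, if p ∣ e i then 0 else 1)
    (hprod : ∏ i, d i = M ^ n) (hm : (∑ i, if 2 ∣ d i then 0 else 1) + m = n) :
    Nonempty (((i : ι) → ZMod (d i)) ≃+
      (Fin m → ZMod 2) × (Fin m → ZMod (M / 2)) × (Fin (n - m) → ZMod M)) := by
  have hd0 : ∀ i, d i ≠ 0 := fun i h => hM (by rw [← hde i, h, zero_mul])
  have he0 : ∀ i, e i ≠ 0 := fun i h => hM (by rw [← hde i, h, mul_zero])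
  obtain ⟨H, rfl⟩ := hM2
  have hH : H ≠ 0 := fun h => hM (by rw [h, mul_zero])
  rw [Nat.mul_div_cancel_left H two_pos]
  -- The last block, of order `1`, pads the target to `2n` cyclic factors so that valuation `0` is
  -- counted too.
  let o : Fin m ⊕ Fin m ⊕ Fin (n - m) ⊕ Fin (n - m) → ℕ :=
    Sum.elim (fun _ => 2) (Sum.elim (fun _ => H) (Sum.elim (fun _ => 2 * H) fun _ => 1))
  have ho : ∀ j, o j ≠ 0 := by rintro (j | j | j | j) <;> simp [o, hH]
  have hadd : ∀ i p, (d i).factorization p + (e i).factorization p = (2 * H).factorization p :=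
    fun i p => by rw [← hde i, Nat.factorization_mul (hd0 i) (he0 i)]; rfl
  have hdvd : ∀ {a p : ℕ}, a ≠ 0 → p.Prime → (p ∣ a ↔ a.factorization p ≠ 0) := fun ha hp => by
    rw [hp.dvd_iff_one_le_factorization ha]; omega
  have hcd : ∀ p, p.Prime → (∑ i, if p ∣ d i then 0 else 1) =
      ∑ i, if (d i).factorization p = 0 then 1 else 0 := fun p hp =>
    Finset.sum_congr rfl fun i _ => by simp [hdvd (hd0 i) hp]
  have hce : ∀ p, p.Prime → (∑ i, if p ∣ e i then 0 else 1) =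
      ∑ i, if (d i).factorization p = (2 * H).factorization p then 1 else 0 := fun p hp =>
    Finset.sum_congr rfl fun i _ => by
      have := hadd i p
      simp only [hdvd (he0 i) hp, ne_eq, ite_not]
      exact if_congr (by omega) rfl rfl
  -- The smaller of the two valuations is at most `1` at `2` and is `0` at odd primes.
  have hmin : ∀ i p, min ((d i).factorization p) ((e i).factorization p) ≤
      (2 : ℕ).factorization p := fun i p => by
    have := (Nat.factorization_le_iff_dvd
      (Nat.gcd_ne_zero_left (hd0 i)) two_ne_zero).2 (hgcd i) p
    rwa [Nat.factorization_gcd (hd0 i) (he0 i)] at this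
  have hmn : m ≤ n := by omega
  have key := nonempty_pi_zmod_addEquiv (d := d) (e := o) hd0 ho fun p hp k => by
    have hrhs : (∑ j, if (o j).factorization p = k then 1 else 0) =
        m * (if (2 : ℕ).factorization p = k then 1 else 0) +
        (m * (if H.factorization p = k then 1 else 0) +
        ((n - m) * (if (2 * H).factorization p = k then 1 else 0) +
        (n - m) * if 0 = k then 1 else 0)) := by
      have hc : ∀ q a : ℕ, (∑ _j : Fin q, if a = k then 1 else 0) = q * if a = k then 1 else 0 :=
        fun q a => by simp
      have h1 : (1 : ℕ).factorization p = 0 := by simp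
      rw [Fintype.sum_sum_type, Fintype.sum_sum_type, Fintype.sum_sum_type]
      exact congrArg₂ _ (hc m ((2 : ℕ).factorization p)) (congrArg₂ _ (hc m (H.factorization p))
        (congrArg₂ _ (hc (n - m) ((2 * H).factorization p))
          ((hc (n - m) ((1 : ℕ).factorization p)).trans (by rw [h1]))))
    have hHf : (2 * H).factorization p = (2 : ℕ).factorization p + H.factorization p := by
      rw [Nat.factorization_mul two_ne_zero hH]; rfl
    rw [hrhs]
    by_cases hp2 : p = 2
    · subst hp2
      have h2 : (2 : ℕ).factorization 2 = 1 := Nat.prime_two.factorization_self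
      rw [h2] at hHf ⊢
      have hHf' : H.factorization 2 = (2 * H).factorization 2 - 1 := by omega
      rw [hHf']
      refine sum_ite_eq_of_eq_zero_or_one_or hcard (by omega) (fun i => ?_) ?_ ?_ ?_ k
      · have h3 := hmin i 2
        have h4 := hadd i 2
        rw [h2] at h3
        rcases min_le_iff.1 h3 with h | h <;> omega
      · rw [← hcd 2 hp]; exact hm
      · rw [← hce 2 hp, ← hcount 2 hp]; exact hm
      · have := congrArg (fun x : ℕ => x.factorization 2) hprod
        simpa [Nat.factorization_prod (fun i _ => hd0 i), Finsupp.finsetSum_apply] using this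
    · have h2 : (2 : ℕ).factorization p = 0 := by
        rw [Nat.prime_two.factorization]; simp [Ne.symm hp2]
      rw [h2, zero_add] at hHf
      rw [h2, hHf, sum_ite_eq_of_eq_zero_or_eq (μ := H.factorization p) hcard (fun i => ?_) ?_ k]
      · obtain ⟨r, rfl⟩ := Nat.exists_eq_add_of_le hmn
        rw [Nat.add_sub_cancel_left]
        ring
      · rw [← hHf, ← hcd p hp, ← hce p hp, hcount p hp]
      · have h3 := hmin i p
        have h4 := hadd i p
        rw [h2] at h3
        rcases min_le_iff.1 h3 with h | h <;> omega
  obtain ⟨φ⟩ := key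
  let ψ : ((j : Fin m ⊕ Fin m ⊕ Fin (n - m) ⊕ Fin (n - m)) → ZMod (o j)) ≃+
      (Fin m → ZMod 2) × (Fin m → ZMod H) × (Fin (n - m) → ZMod (2 * H)) :=
    { toFun := fun x => (fun j => x (.inl j), fun j => x (.inr (.inl j)),
        fun j => x (.inr (.inr (.inl j))))
      invFun := fun y j => match j with
        | .inl j => y.1 j
        | .inr (.inl j) => y.2.1 j
        | .inr (.inr (.inl j)) => y.2.2 j
        | .inr (.inr (.inr _)) => (0 : ZMod 1)
      left_inv := fun x => by
        funext j
        rcases j with j | j | j | j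
        · rfl
        · rfl
        · rfl
        · exact Subsingleton.elim (α := ZMod 1) _ _
      right_inv := fun y => rfl
      map_add' := fun x y => rfl }
  exact ⟨φ.trans ψ⟩

/-- The cokernel of an integer matrix `L` that divides `M`, is similar to its cofactor `L'` in
that factorization, and satisfies `T * L - L' * T = -2` for some `T`. -/
theorem Matrix.nonempty_quotient_range_addEquiv {ι : Type*} [Fintype ι] [DecidableEq ι]
    {L L' T J : Matrix ι ι ℤ} {M n : ℕ} (hM : M ≠ 0) (hM2 : 2 ∣ M)
    (hcard : Fintype.card ι = 2 * n) (hLL : L * L' = (M : ℤ) • 1)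
    (hT : T * L - L' * T = (-2 : ℤ) • 1) (hJ : J * J = 1) (hJL : J * L * J = L') :
    (L.map (Int.castRingHom (ZMod 2))).rank ≤ n ∧
    ∀ m, (L.map (Int.castRingHom (ZMod 2))).rank + m = n →
      Nonempty (((ι → ℤ) ⧸ LinearMap.range L.mulVecLin) ≃+
        (Fin m → ZMod 2) × (Fin m → ZMod (M / 2)) × (Fin (n - m) → ZMod M)) := by
  have hMz : (M : ℤ) ≠ 0 := by exact_mod_cast hM
  have hJdet : J.det * J.det = 1 := by rw [← Matrix.det_mul, hJ, Matrix.det_one]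
  have hJu : IsUnit J.det := IsUnit.of_mul_eq_one _ hJdet
  have hdet' : L'.det = L.det := by
    rw [← hJL, Matrix.det_mul, Matrix.det_mul, mul_right_comm, hJdet, one_mul]
  have hdet : L.det * L.det = (M : ℤ) ^ (2 * n) := by
    have := congrArg Matrix.det hLL
    rwa [Matrix.det_mul, hdet', Matrix.det_smul, Matrix.det_one, mul_one, hcard] at this
  have hL0 : L.det ≠ 0 := fun h => by
    rw [h, zero_mul] at hdet
    exact pow_ne_zero _ hMz hdet.symm
  obtain ⟨P, Q, d, hP, hQ, hLQ, ⟨φ⟩⟩ := L.exists_mul_eq_mul_diagonal hL0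
  have hD : P⁻¹ * L * Q = Matrix.diagonal d := by
    rw [mul_assoc, hLQ, ← mul_assoc, Matrix.nonsing_inv_mul _ hP, one_mul]
  -- The cofactor in the new bases is `M D⁻¹`, hence diagonal because every `d i` is nonzero.
  have hDE : Matrix.diagonal d * (Q⁻¹ * L' * P) = (M : ℤ) • 1 := by
    calc Matrix.diagonal d * (Q⁻¹ * L' * P) = P⁻¹ * L * (Q * Q⁻¹) * L' * P := by
          rw [← hD]; simp only [mul_assoc]
      _ = P⁻¹ * (L * L') * P := by
          rw [Matrix.mul_nonsing_inv _ hQ, mul_one, mul_assoc P⁻¹]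
      _ = (M : ℤ) • 1 := by
          rw [hLL, mul_smul_comm, mul_one, smul_mul_assoc, Matrix.nonsing_inv_mul _ hP]
  have hentry : ∀ i j, d i * (Q⁻¹ * L' * P) i j = (M : ℤ) * (1 : Matrix ι ι ℤ) i j := fun i j => by
    have := congrFun (congrFun hDE i) j
    rwa [Matrix.diagonal_mul, Matrix.smul_apply, smul_eq_mul] at this
  set e : ι → ℤ := fun i => (Q⁻¹ * L' * P) i i with he
  have hde : ∀ i, d i * e i = M := fun i => by simpa using hentry i i
  have hE : Q⁻¹ * L' * P = Matrix.diagonal e := by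
    ext i j
    by_cases hij : i = j
    · subst hij; simp [he]
    · have := hentry i j
      rw [Matrix.one_apply_ne hij, mul_zero] at this
      rw [Matrix.diagonal_apply_ne _ hij]
      exact (mul_eq_zero.1 this).resolve_left fun h => hMz (by rw [← hde i, h, zero_mul])
  have hL'P : L' * P = Q * Matrix.diagonal e := by
    rw [← hE, mul_assoc, ← mul_assoc Q, Matrix.mul_nonsing_inv _ hQ, one_mul]
  have hrel : Q⁻¹ * T * P * Matrix.diagonal d - Matrix.diagonal e * (P⁻¹ * T * Q) =
      (-2 : ℤ) • 1 := by
    calc _ = Q⁻¹ * T * (P * P⁻¹) * L * Q - Q⁻¹ * L' * (P * P⁻¹) * T * Q := by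
          rw [← hD, ← hE]; simp only [mul_assoc]
      _ = Q⁻¹ * (T * L - L' * T) * Q := by
          rw [Matrix.mul_nonsing_inv _ hP, mul_one, mul_one, mul_sub, sub_mul]
          simp only [mul_assoc]
      _ = (-2 : ℤ) • 1 := by
          rw [hT, mul_smul_comm, mul_one, smul_mul_assoc, Matrix.nonsing_inv_mul _ hQ]
  -- A diagonal entry of `hrel` writes `-2` as an integer combination of `d i` and `e i`.
  have hgcd : ∀ i, (d i).natAbs.gcd (e i).natAbs ∣ 2 := fun i => by
    have h := congrFun (congrFun hrel i) i
    simp only [Matrix.sub_apply, Matrix.mul_diagonal, Matrix.diagonal_mul, Matrix.smul_apply,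
      Matrix.one_apply_eq, smul_eq_mul, mul_one] at h
    have h2 : ((Int.gcd (d i) (e i) : ℕ) : ℤ) ∣ -2 := by
      rw [← h]
      exact dvd_sub ((Int.gcd_dvd_left ..).mul_left _) ((Int.gcd_dvd_right ..).mul_right _)
    exact_mod_cast (dvd_neg.1 h2)
  have hnat : ∀ (x : ι → ℤ) (p : ℕ), (∑ i, if (p : ℤ) ∣ x i then 0 else 1) =
      ∑ i, if p ∣ (x i).natAbs then 0 else 1 := fun x p =>
    Finset.sum_congr rfl fun i _ => if_congr Int.natCast_dvd rfl rfl
  have hrank : ∀ p, p.Prime → (∑ i, if p ∣ (d i).natAbs then 0 else 1) =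
      ∑ i, if p ∣ (e i).natAbs then 0 else 1 := fun p hp => by
    have : Fact p.Prime := ⟨hp⟩
    rw [← hnat, ← hnat, ← Matrix.rank_map_zmod_of_mul_eq_mul_diagonal hP hQ hLQ p,
      ← Matrix.rank_map_zmod_of_mul_eq_mul_diagonal hQ hP hL'P p, ← hJL, Matrix.map_mul,
      Matrix.map_mul]
    have hu : IsUnit (J.map (Int.castRingHom (ZMod p))).det := by
      have := hJu.map (Int.castRingHom (ZMod p))
      rwa [RingHom.map_det] at this
    rw [Matrix.rank_mul_eq_left_of_isUnit_det _ _ hu, Matrix.rank_mul_eq_right_of_isUnit_det _ _ hu]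
  have hprod : ∏ i, (d i).natAbs = M ^ n := by
    have h1 := congrArg (fun X => (Matrix.det X).natAbs) hLQ
    simp only [Matrix.det_mul, Matrix.det_diagonal, Int.natAbs_mul,
      Int.isUnit_iff_natAbs_eq.1 hP, Int.isUnit_iff_natAbs_eq.1 hQ, mul_one, one_mul] at h1
    have h2 : L.det.natAbs * L.det.natAbs = M ^ n * M ^ n := by
      rw [← Int.natAbs_mul, hdet, Int.natAbs_pow, Int.natAbs_natCast]; ring
    have h3 : (∏ i, d i).natAbs = ∏ i, (d i).natAbs := map_prod Int.natAbsHom _ _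
    rw [← h3, ← h1]
    exact Nat.mul_self_inj.1 h2
  have hdeN : ∀ i, (d i).natAbs * (e i).natAbs = M := fun i => by
    rw [← Int.natAbs_mul, hde, Int.natAbs_natCast]
  have hr2 : (L.map (Int.castRingHom (ZMod 2))).rank = ∑ i, if 2 ∣ (d i).natAbs then 0 else 1 := by
    rw [Matrix.rank_map_zmod_of_mul_eq_mul_diagonal hP hQ hLQ 2, hnat]
  refine ⟨?_, fun m hm => ?_⟩
  -- As `M` is even, no index has both `d i` and `e i` odd; the two counts of odd entries are equal,
  -- so each is at most `n`.
  · have h1 : (∑ i, if 2 ∣ (d i).natAbs then 0 else 1) +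
        (∑ i, if 2 ∣ (e i).natAbs then 0 else 1) ≤ ∑ _i : ι, 1 := by
      rw [← Finset.sum_add_distrib]
      refine Finset.sum_le_sum fun i _ => ?_
      have : 2 ∣ (d i).natAbs ∨ 2 ∣ (e i).natAbs :=
        (Nat.prime_two.dvd_mul).1 (by rw [hdeN]; exact hM2)
      rcases this with h | h <;> simp only [h, if_true] <;> split_ifs <;> simp
    rw [← hrank 2 Nat.prime_two, ← hr2] at h1
    simp only [Finset.sum_const, Finset.card_univ, hcard, smul_eq_mul, mul_one] at h1
    omega
  · obtain ⟨ψ⟩ := nonempty_pi_zmod_addEquiv_of_mul_eq hM hM2 hcard hdeN hgcd hrank hprod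
      (by rw [← hr2]; exact hm)
    exact ⟨φ.trans ψ⟩

/-! ### Edge signs and 4-cycles -/

namespace SignedGraph

variable {V : Type*} (S : SignedGraph V) [DecidableRel S.graph.Adj]

theorem signedAdjMatrix_of_adj {x y : V} (h : S.graph.Adj x y) :
    S.signedAdjMatrix x y = ((S.sign ⟨s(x, y), h⟩ : ℤˣ) : ℤ) := by
  simp [signedAdjMatrix, h, SimpleGraph.EdgeLabeling.get_eq]

theorem signedAdjMatrix_of_not_adj {x y : V} (h : ¬ S.graph.Adj x y) :
    S.signedAdjMatrix x y = 0 := by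
  simp [signedAdjMatrix, h]

theorem signedAdjMatrix_comm (x y : V) : S.signedAdjMatrix x y = S.signedAdjMatrix y x := by
  by_cases h : S.graph.Adj x y
  · rw [S.signedAdjMatrix_of_adj h, S.signedAdjMatrix_of_adj h.symm]
    congr 3
    exact Sym2.eq_swap
  · rw [S.signedAdjMatrix_of_not_adj h, S.signedAdjMatrix_of_not_adj fun h' => h h'.symm]

/-- On an edge, the signed adjacency matrix is `-1` or `1` according to `negGraph`. -/
theorem signedAdjMatrix_eq_ite {x y : V} (h : S.graph.Adj x y)
    [Decidable (s(x, y) ∈ S.negGraph.edgeSet)] :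
    S.signedAdjMatrix x y = if s(x, y) ∈ S.negGraph.edgeSet then -1 else 1 := by
  rw [S.signedAdjMatrix_of_adj h]
  have : s(x, y) ∈ S.negGraph.edgeSet ↔ S.sign ⟨s(x, y), h⟩ = -1 := by
    rw [SimpleGraph.mem_edgeSet, negGraph, SimpleGraph.EdgeLabeling.labelGraph_adj]
    exact ⟨fun ⟨_, h⟩ => h, fun h' => ⟨h, h'⟩⟩
  rcases Int.units_eq_one_or (S.sign ⟨s(x, y), h⟩) with h1 | h1
  · rw [if_neg (by rw [this, h1]; decide), h1]; rfl
  · rw [if_pos (this.2 h1), h1]; rfl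

theorem signedAdjMatrix_mul_self {x y : V} (h : S.graph.Adj x y) :
    S.signedAdjMatrix x y * S.signedAdjMatrix x y = 1 := by
  rw [S.signedAdjMatrix_of_adj h, ← Units.val_mul, Int.units_mul_self, Units.val_one]

end SignedGraph

/-- A sign count: four distinct elements, an odd number of them in `t`. -/
theorem prod_ite_eq_neg_one_of_odd_ncard {α : Type*} {a b c d : α} {t : Set α}
    [DecidablePred (· ∈ t)] (hnd : [a, b, c, d].Nodup)
    (h : Odd (({a, b, c, d} : Set α) ∩ t).ncard) :
    (if a ∈ t then (-1 : ℤ) else 1) * (if b ∈ t then -1 else 1) * (if c ∈ t then -1 else 1) *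
      (if d ∈ t then -1 else 1) = -1 := by
  classical
  have hset : (({a, b, c, d} : Set α) ∩ t) = ↑(({a, b, c, d} : Finset α).filter (· ∈ t)) := by
    ext x; simp
  rw [hset, Set.ncard_coe_finset] at h
  have h1 := h.neg_one_pow (α := ℤ)
  rw [← Finset.prod_const, Finset.prod_filter] at h1
  simp only [List.nodup_cons, List.mem_cons, List.not_mem_nil, or_false, not_or] at hnd
  obtain ⟨⟨hab, hac, had⟩, ⟨hbc, hbd⟩, hcd, -⟩ := hnd
  rw [Finset.prod_insert (by simp [hab, hac, had]), Finset.prod_insert (by simp [hbc, hbd]),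
    Finset.prod_insert (by simp [hcd]), Finset.prod_singleton] at h1
  rw [mul_assoc, mul_assoc]
  exact h1

/-- In a 4-cycle, two distinct neighbors of a vertex have the same other neighbor. -/
theorem SimpleGraph.cycleGraph_four_eq_of_adj : ∀ x a b c d : Fin 4,
    (SimpleGraph.cycleGraph 4).Adj x a → (SimpleGraph.cycleGraph 4).Adj x b → a ≠ b →
    (SimpleGraph.cycleGraph 4).Adj a c → c ≠ x → (SimpleGraph.cycleGraph 4).Adj b d → d ≠ x →
    c = d := by
  simp only [SimpleGraph.cycleGraph_adj']
  decide

/-! ### Colors as commuting matchings -/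

namespace Adinkra

variable {V : Type*} {N : ℕ} (A : Adinkra V N)

theorem existsUnique_labelGraph_adj (i : Fin N) (x : V) :
    ∃! y, (A.color.labelGraph i).Adj x y := by
  obtain ⟨⟨e, he⟩, ⟨hx, hc⟩, huniq⟩ := A.existsUnique_edge x i
  obtain ⟨y, rfl⟩ := Sym2.mem_iff_exists.1 hx
  refine ⟨y, (SimpleGraph.EdgeLabeling.labelGraph_adj _ _).2 ⟨he, hc⟩, fun z hz => ?_⟩
  obtain ⟨h, hz⟩ := (SimpleGraph.EdgeLabeling.labelGraph_adj _ _).1 hz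
  have := congrArg Subtype.val (huniq ⟨s(x, z), h⟩ ⟨Sym2.mem_mk_left _ _, hz⟩)
  exact Sym2.congr_right.1 this

/-- The neighbor of a vertex along the edge of a given color. -/
noncomputable def neighbor (i : Fin N) (x : V) : V := (A.existsUnique_labelGraph_adj i x).choose

theorem labelGraph_adj_neighbor (i : Fin N) (x : V) :
    (A.color.labelGraph i).Adj x (A.neighbor i x) :=
  (A.existsUnique_labelGraph_adj i x).choose_spec.1

theorem adj_neighbor (i : Fin N) (x : V) : A.graph.Adj x (A.neighbor i x) :=
  A.color.labelGraph_le (A.labelGraph_adj_neighbor i x)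

theorem eq_neighbor {i : Fin N} {x y : V} (h : (A.color.labelGraph i).Adj x y) :
    y = A.neighbor i x :=
  (A.existsUnique_labelGraph_adj i x).choose_spec.2 y h

theorem neighbor_neighbor (i : Fin N) (x : V) : A.neighbor i (A.neighbor i x) = x :=
  (A.eq_neighbor (A.labelGraph_adj_neighbor i x).symm).symm

theorem neighbor_ne_self (i : Fin N) (x : V) : A.neighbor i x ≠ x :=
  (A.adj_neighbor i x).ne'

theorem neighbor_ne_neighbor {i j : Fin N} (h : i ≠ j) (x : V) :
    A.neighbor i x ≠ A.neighbor j x := fun he => by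
  obtain ⟨h1, h2⟩ := (SimpleGraph.EdgeLabeling.labelGraph_adj _ _).1 (A.labelGraph_adj_neighbor i x)
  have h3 := A.labelGraph_adj_neighbor j x
  rw [← he] at h3
  obtain ⟨h4, h5⟩ := (SimpleGraph.EdgeLabeling.labelGraph_adj _ _).1 h3
  exact h (h2.symm.trans h5)

theorem neighbor_neighbor_ne {i j : Fin N} (h : i ≠ j) (x : V) :
    A.neighbor j (A.neighbor i x) ≠ x := fun he =>
  A.neighbor_ne_neighbor h x (by
    have := congrArg (A.neighbor j) he
    rwa [A.neighbor_neighbor] at this)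

/-- Neighbor maps of different colors commute. -/
theorem neighbor_comm {i j : Fin N} (h : i ≠ j) (x : V) :
    A.neighbor j (A.neighbor i x) = A.neighbor i (A.neighbor j x) := by
  set B := A.color.bicolorGraph i j with hB
  have hi : ∀ y, B.Adj y (A.neighbor i y) := fun y => Or.inl (A.labelGraph_adj_neighbor i y)
  have hj : ∀ y, B.Adj y (A.neighbor j y) := fun y => Or.inr (A.labelGraph_adj_neighbor j y)
  obtain ⟨φ⟩ := A.bicolor_component i j h (B.connectedComponentMk x)
  have mem_of_adj : ∀ {y z : V}, y ∈ B.connectedComponentMk x → B.Adj y z →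
      z ∈ B.connectedComponentMk x := fun hy hyz => by
    exact (SimpleGraph.ConnectedComponent.sound hyz.symm.reachable).trans hy
  have hx : x ∈ B.connectedComponentMk x := rfl
  have ha := mem_of_adj hx (hi x)
  have hb := mem_of_adj hx (hj x)
  have hc := mem_of_adj ha (hj (A.neighbor i x))
  have hd := mem_of_adj hb (hi (A.neighbor j x))
  -- Both two-step paths reach the vertex opposite `x` in its bicolored square.
  have key := SimpleGraph.cycleGraph_four_eq_of_adj (φ ⟨x, hx⟩) (φ ⟨_, ha⟩) (φ ⟨_, hb⟩) (φ ⟨_, hc⟩)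
    (φ ⟨_, hd⟩) (φ.map_adj_iff.2 (hi x)) (φ.map_adj_iff.2 (hj x))
    (fun he => A.neighbor_ne_neighbor h x (congrArg Subtype.val (φ.injective he)))
    (φ.map_adj_iff.2 (hj _))
    (fun he => A.neighbor_neighbor_ne h x (congrArg Subtype.val (φ.injective he)))
    (φ.map_adj_iff.2 (hi _))
    (fun he => A.neighbor_neighbor_ne h.symm x (congrArg Subtype.val (φ.injective he)))
  exact congrArg Subtype.val (φ.injective key)

/-- The edges of a single color form a perfect matching, that is, an involution without fixed
points. -/
theorem even_card {V : Type*} [Fintype V] {N : ℕ} (A : Adinkra V N) (hN : 2 ≤ N) :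
    Even (Fintype.card V) := by
  let i : Fin N := ⟨0, by omega⟩
  have h : ∑ _x : V, (1 : ZMod 2) = 0 :=
    Finset.sum_involution (fun x _ => A.neighbor i x) (fun _ _ => by decide)
      (fun x _ _ => A.neighbor_ne_self i x) (fun _ _ => Finset.mem_univ _)
      (fun x _ => A.neighbor_neighbor i x)
  rw [Finset.sum_const, Finset.card_univ, nsmul_one] at h
  exact (ZMod.natCast_eq_zero_iff_even).1 h

variable [DecidableRel A.graph.Adj]

/-- The two bicolored paths from a vertex to the opposite vertex of a square have opposite
signs. -/
theorem signedAdjMatrix_mul_neighbor {i j : Fin N} (h : i ≠ j) (x : V) :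
    A.signedAdjMatrix x (A.neighbor i x) *
      A.signedAdjMatrix (A.neighbor i x) (A.neighbor j (A.neighbor i x)) =
    -(A.signedAdjMatrix x (A.neighbor j x) *
      A.signedAdjMatrix (A.neighbor j x) (A.neighbor i (A.neighbor j x))) := by
  classical
  have hcomm := A.neighbor_comm h x
  set B := A.color.bicolorGraph i j with hB
  have hi : ∀ y, B.Adj y (A.neighbor i y) := fun y => Or.inl (A.labelGraph_adj_neighbor i y)
  have hj : ∀ y, B.Adj y (A.neighbor j y) := fun y => Or.inr (A.labelGraph_adj_neighbor j y)
  have hxa := hi x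
  have hac := hj (A.neighbor i x)
  have hbx := hj x
  have hcb := hi (A.neighbor j x)
  have gxa := A.adj_neighbor i x
  have gac := A.adj_neighbor j (A.neighbor i x)
  have gbx := A.adj_neighbor j x
  have gcb := A.adj_neighbor i (A.neighbor j x)
  have nab := A.neighbor_ne_neighbor h x
  have nxc := A.neighbor_neighbor_ne h x
  -- Both paths now end at the same term, so the square becomes `x, a, c, b`.
  rw [← hcomm] at hcb gcb ⊢
  generalize A.neighbor j (A.neighbor i x) = c at *
  generalize A.neighbor i x = a at *
  generalize A.neighbor j x = b at *
  have hodd := A.odd_negative i j h x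
    (.cons hxa (.cons hac (.cons hcb.symm (.cons hbx.symm .nil))))
  have nxa := gxa.ne
  have nac := gac.ne
  have nxb := gbx.ne
  have nbc := gcb.ne
  have hnd : [s(x, a), s(a, c), s(c, b), s(b, x)].Nodup := by
    simp
    grind
  have h1 := hodd (by
    rw [SimpleGraph.Walk.cons_isCycle_iff]
    simp [SimpleGraph.Walk.isPath_def]
    grind) rfl
  have hset : (SimpleGraph.Walk.cons hxa (.cons hac (.cons hcb.symm (.cons hbx.symm
      .nil)))).edgeSet = {s(x, a), s(a, c), s(c, b), s(b, x)} := by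
    ext e; simp
  rw [hset] at h1
  have h2 := prod_ite_eq_neg_one_of_odd_ncard hnd h1
  rw [← A.signedAdjMatrix_eq_ite gxa, ← A.signedAdjMatrix_eq_ite gac,
    ← A.signedAdjMatrix_eq_ite gcb.symm, ← A.signedAdjMatrix_eq_ite gbx.symm,
    A.signedAdjMatrix_comm c b, A.signedAdjMatrix_comm b x] at h2
  have h3 := A.signedAdjMatrix_mul_self gcb
  have h4 := A.signedAdjMatrix_mul_self gbx
  set w := A.signedAdjMatrix x a * A.signedAdjMatrix a c
  -- `h2` says that the product of the four signs is `-1`; multiplying by the signs of `bc` and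
  -- `xb`, whose squares are `1`, moves them to the other side.
  linear_combination (A.signedAdjMatrix b c * A.signedAdjMatrix x b) * h2
    - w * A.signedAdjMatrix x b * A.signedAdjMatrix x b * h3 - w * h4

/-! ### Clifford relations and the Laplacian -/

/-- The part of the signed adjacency matrix supported on one color. -/
noncomputable def colorMatrix [DecidableEq V] (i : Fin N) : Matrix V V ℤ :=
  Matrix.of fun x y => if y = A.neighbor i x then A.signedAdjMatrix x y else 0

variable [DecidableEq V]

theorem sum_colorMatrix : ∑ i, A.colorMatrix i = A.signedAdjMatrix := by
  ext x y
  rw [Matrix.sum_apply]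
  simp only [colorMatrix, Matrix.of_apply]
  by_cases h : A.graph.Adj x y
  · have hc : ∀ i, y = A.neighbor i x ↔ i = A.color ⟨s(x, y), h⟩ := fun i => by
      constructor
      · rintro hy
        have := A.labelGraph_adj_neighbor i x
        rw [← hy] at this
        obtain ⟨_, h'⟩ := (SimpleGraph.EdgeLabeling.labelGraph_adj _ _).1 this
        exact h'.symm
      · rintro rfl
        exact A.eq_neighbor ((SimpleGraph.EdgeLabeling.labelGraph_adj _ _).2 ⟨h, rfl⟩)
    simp [hc]
  · simp [A.signedAdjMatrix_of_not_adj h]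

variable [Fintype V]

theorem colorMatrix_mul_apply (i j : Fin N) (x z : V) :
    (A.colorMatrix i * A.colorMatrix j) x z = if z = A.neighbor j (A.neighbor i x) then
      A.signedAdjMatrix x (A.neighbor i x) * A.signedAdjMatrix (A.neighbor i x) z else 0 := by
  rw [Matrix.mul_apply, Finset.sum_eq_single (A.neighbor i x) (fun y _ hy => ?_) (by simp)]
  · simp [colorMatrix]
  · simp [colorMatrix, hy]

theorem colorMatrix_mul_self (i : Fin N) : A.colorMatrix i * A.colorMatrix i = 1 := by
  ext x z
  rw [colorMatrix_mul_apply, neighbor_neighbor]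
  by_cases h : z = x
  · subst h
    rw [if_pos rfl, A.signedAdjMatrix_comm (A.neighbor i z) z,
      A.signedAdjMatrix_mul_self (A.adj_neighbor i z), Matrix.one_apply_eq]
  · rw [if_neg h, Matrix.one_apply_ne (Ne.symm h)]

/-- Both products are supported on the same pairs because the matchings commute, and the odd square
makes their entries opposite. -/
theorem colorMatrix_anticomm {i j : Fin N} (h : i ≠ j) :
    A.colorMatrix i * A.colorMatrix j + A.colorMatrix j * A.colorMatrix i = 0 := by
  ext x z
  rw [Matrix.add_apply, colorMatrix_mul_apply, colorMatrix_mul_apply, ← A.neighbor_comm h]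
  split_ifs with hz
  · have := A.signedAdjMatrix_mul_neighbor h x
    rw [← A.neighbor_comm h x, ← hz] at this
    rw [this]; simp
  · simp

/-- Each color matrix anticommutes with the signed adjacency matrix up to a scalar. -/
theorem colorMatrix_mul_signedAdjMatrix_add (i : Fin N) :
    A.colorMatrix i * A.signedAdjMatrix + A.signedAdjMatrix * A.colorMatrix i = (2 : ℤ) • 1 := by
  rw [← A.sum_colorMatrix, Finset.mul_sum, Finset.sum_mul, ← Finset.sum_add_distrib,
    Finset.sum_eq_single i (fun j _ hj => A.colorMatrix_anticomm hj.symm) (by simp),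
    A.colorMatrix_mul_self, two_smul]

/-- Summing the relation of each color matrix with `S` over all colors gives `2 S² = 2N`, and `2`
cancels over `ℤ`. -/
theorem signedAdjMatrix_sq : A.signedAdjMatrix * A.signedAdjMatrix = (N : ℤ) • 1 := by
  have h : (2 : ℤ) • (A.signedAdjMatrix * A.signedAdjMatrix) = (2 : ℤ) • ((N : ℤ) • 1) := by
    calc (2 : ℤ) • (A.signedAdjMatrix * A.signedAdjMatrix)
        = ∑ i, (A.colorMatrix i * A.signedAdjMatrix + A.signedAdjMatrix * A.colorMatrix i) := by
          rw [Finset.sum_add_distrib, ← Finset.sum_mul, ← Finset.mul_sum, A.sum_colorMatrix,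
            two_smul]
      _ = (2 : ℤ) • ((N : ℤ) • 1) := by
          simp only [A.colorMatrix_mul_signedAdjMatrix_add, Finset.sum_const, Finset.card_univ,
            Fintype.card_fin]
          rw [smul_comm, natCast_zsmul]
  exact smul_right_injective _ two_ne_zero h

theorem degree_eq (x : V) : A.graph.degree x = N := by
  have h : A.graph.neighborFinset x = Finset.univ.image fun i => A.neighbor i x := by
    ext y
    simp only [SimpleGraph.mem_neighborFinset, Finset.mem_image, Finset.mem_univ, true_and]
    constructor
    · exact fun hy => ⟨A.color ⟨s(x, y), hy⟩,
        (A.eq_neighbor ((SimpleGraph.EdgeLabeling.labelGraph_adj _ _).2 ⟨hy, rfl⟩)).symm⟩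
    · rintro ⟨i, rfl⟩
      exact A.adj_neighbor i x
  rw [← SimpleGraph.card_neighborFinset_eq_degree, h, Finset.card_image_of_injective,
    Finset.card_univ, Fintype.card_fin]
  intro i j hij
  by_contra hne
  exact A.neighbor_ne_neighbor hne x hij

theorem laplacian_eq : A.laplacian = (N : ℤ) • 1 - A.signedAdjMatrix := by
  rw [SignedGraph.laplacian]
  congr 1
  ext x y
  rw [SimpleGraph.degMatrix, Matrix.diagonal_apply, Matrix.smul_apply, Matrix.one_apply]
  simp [A.degree_eq]

/-- Conjugation by the sign of the bipartition negates the signed adjacency matrix. -/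
theorem exists_conj_signedAdjMatrix : ∃ J : Matrix V V ℤ, J * J = 1 ∧
    J * A.signedAdjMatrix * J = -A.signedAdjMatrix := by
  obtain ⟨c⟩ := A.bipartite
  refine ⟨Matrix.diagonal fun x => if c x = 0 then 1 else -1, ?_, ?_⟩
  · rw [Matrix.diagonal_mul_diagonal, ← Matrix.diagonal_one]
    congr 1
    funext x
    split_ifs <;> rfl
  · ext x y
    rw [Matrix.mul_diagonal, Matrix.diagonal_mul, Matrix.neg_apply]
    by_cases h : A.graph.Adj x y
    · have := c.valid h
      split_ifs with h1 h2 h2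
      · exact absurd (h1.trans h2.symm) this
      · ring
      · ring
      · exfalso; omega
    · simp [A.signedAdjMatrix_of_not_adj h]

/-- Since `-1 = 1` modulo `2`, the 2-rank does not see the signature. -/
theorem laplacian_map_zmod_two : A.laplacian.map (Int.castRingHom (ZMod 2)) =
    (A.graph.lapMatrix ℤ).map (Int.castRingHom (ZMod 2)) := by
  ext x y
  simp only [SignedGraph.laplacian, SimpleGraph.lapMatrix, Matrix.map_apply, Matrix.sub_apply,
    map_sub]
  congr 1
  by_cases h : A.graph.Adj x y
  · rw [A.signedAdjMatrix_of_adj h, SimpleGraph.adjMatrix_apply, if_pos h]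
    rcases Int.units_eq_one_or (A.sign ⟨s(x, y), h⟩) with h1 | h1 <;> rw [h1] <;> decide
  · simp [A.signedAdjMatrix_of_not_adj h, h]

end Adinkra

/-! ### The critical group -/

theorem theorem1p2 {V : Type*} [Fintype V] [DecidableEq V] {N : ℕ} (hN : 2 ≤ N)
    (A : Adinkra V N) [DecidableRel A.graph.Adj] :
    Even (Fintype.card V) ∧
    A.graph.laplacianTwoRank ≤ Fintype.card V / 2 ∧
    ∀ m : ℕ, A.graph.laplacianTwoRank + m = Fintype.card V / 2 →
      Nonempty (A.toSignedGraph.CriticalGroup ≃+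
        (Fin m → ZMod 2) × (Fin m → ZMod ((N ^ 2 - N) / 2)) ×
          (Fin (Fintype.card V / 2 - m) → ZMod (N ^ 2 - N))) := by
  have heven := A.even_card hN
  have hcard : Fintype.card V = 2 * (Fintype.card V / 2) := (Nat.two_mul_div_two_of_even heven).symm
  have hle : N ≤ N ^ 2 := Nat.le_self_pow two_ne_zero N
  have hM : N ^ 2 - N ≠ 0 := by
    have : N < N ^ 2 := by nlinarith
    omega
  have hM2 : 2 ∣ N ^ 2 - N := by
    rw [sq, ← Nat.mul_sub_one]
    exact (Nat.even_mul_pred_self N).two_dvd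
  obtain ⟨J, hJ, hJS⟩ := A.exists_conj_signedAdjMatrix
  have hLL : A.laplacian * ((N : ℤ) • 1 + A.signedAdjMatrix) =
      ((N ^ 2 - N : ℕ) : ℤ) • 1 := by
    rw [A.laplacian_eq, sub_mul, mul_add, mul_add, A.signedAdjMatrix_sq]
    simp only [smul_mul_assoc, mul_smul_comm, one_mul, mul_one]
    push_cast [hle]
    module
  -- Any color would do; `2 ≤ N` guarantees that color `0` exists.
  have hT := A.colorMatrix_mul_signedAdjMatrix_add ⟨0, by omega⟩
  set T := A.colorMatrix ⟨0, by omega⟩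
  have hTL : T * A.laplacian - ((N : ℤ) • 1 + A.signedAdjMatrix) * T = (-2 : ℤ) • 1 := by
    rw [A.laplacian_eq, mul_sub, add_mul, mul_smul_comm, smul_mul_assoc, mul_one, one_mul,
      neg_smul, ← hT]
    abel
  have hJL : J * A.laplacian * J = (N : ℤ) • 1 + A.signedAdjMatrix := by
    rw [A.laplacian_eq, mul_sub, sub_mul, hJS, mul_smul_comm, smul_mul_assoc, mul_one, hJ,
      sub_neg_eq_add]
  obtain ⟨hrank, hiso⟩ := Matrix.nonempty_quotient_range_addEquiv hM hM2 hcard hLL hTL hJ hJL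
  rw [A.laplacian_map_zmod_two] at hrank hiso
  refine ⟨heven, hrank, fun m hm => ?_⟩
  obtain ⟨φ⟩ := hiso m hm
  -- `M` annihilates the cokernel, because `M y = L (L' y)`.
  have htop : Submodule.torsion ℤ ((V → ℤ) ⧸ LinearMap.range A.laplacian.mulVecLin) = ⊤ := by
    rw [eq_top_iff]
    rintro x -
    refine (Submodule.mem_torsion_iff x).2
      ⟨⟨((N ^ 2 - N : ℕ) : ℤ), mem_nonZeroDivisors_of_ne_zero (by exact_mod_cast hM)⟩, ?_⟩
    obtain ⟨y, rfl⟩ := Submodule.Quotient.mk_surjective _ x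
    change ((N ^ 2 - N : ℕ) : ℤ) •
      (Submodule.Quotient.mk y : (V → ℤ) ⧸ LinearMap.range A.laplacian.mulVecLin) = 0
    rw [← Submodule.Quotient.mk_smul, Submodule.Quotient.mk_eq_zero]
    refine ⟨((N : ℤ) • 1 + A.signedAdjMatrix).mulVec y, ?_⟩
    rw [Matrix.mulVecLin_apply, Matrix.mulVec_mulVec, hLL, Matrix.smul_mulVec, Matrix.one_mulVec]
  exact ⟨((LinearEquiv.ofEq _ _ htop).trans Submodule.topEquiv).toAddEquiv.trans φ⟩
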